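/- **Conventions.** Let $M=\mathbb{R}^n$ carry a smooth field $g$ of symmetric bilinear forms on its tangent spaces, possibly degenerate and of variable signature. Let $\flat_p:T_pM\to T_p^*M$, $X^\flat=g_p(X,\cdot)$, and let $g_\bullet(X^\flat,Y^\flat):=g_p(X,Y)$ be the induced inner product on $\flat_p(T_pM)$; $\bullet$ denotes contraction of covariant slots with $g_\bullet$. The Koszul form is $$\mathcal K(X,Y,Z)=\tfrac12\{X g(Y,Z)+Y g(Z,X)-Z g(X,Y)-g(X,[Y,Z])+g(Y,[Z,X])+g(Z,[X,Y])\}.$$ The metric $g$ is *semi-regular* if for all smooth local vector fields $X,Y,Z,T$ the $1$-form $\mathcal K(X,Y,\cdot)$ lies in $\flat_p(T_pM)$ at every point $p$, and the contraction $\mathcal K(X,Y,\bullet)\,\mathcal K(Z,T,\bullet)$ is smooth, in the sense that it extends smoothly across the points where the signature changes: on the common domain $U$ of the fields there is a smooth function that equals the contraction at each point of $U$ near which the rank of $g$ is constant. With $\Gamma_{abc}=\mathcal K(\partial_a,\partial_b,\partial_c)$ put $R_{abcd}=\partial_a\Gamma_{bcd}-\partial_b\Gamma_{acd}+\Gamma_{ac\bullet}\Gamma_{bd\bullet}-\Gamma_{bc\bullet}\Gamma_{ad\bullet}$,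 and, where $g$ is non-degenerate, $R_{ab}=g^{st}R_{asbt}$, $R=g^{st}R_{st}$, $S_{ab}=R_{ab}-\frac1n R\,g_{ab}$, $$S_{abcd}=\frac{1}{2n(n-1)}R\,(g\circ g)_{abcd},\qquad E_{abcd}=\frac1{n-2}(S\circ g)_{abcd},$$ where $(h\circ k)_{abcd}=h_{ac}k_{bd}-h_{ad}k_{bc}+h_{bd}k_{ac}-h_{bc}k_{ad}$. The metric $g$ is *quasi-regular* if it is semi-regular, it is non-degenerate on a dense set, and the tensors $S_{abcd}$ and $E_{abcd}$, defined where $g$ is non-degenerate, extend smoothly to all of $M$. **Proposition (Semi-regular manifold which is not quasi-regular).** Let $B=\mathbb{R}^k$ with $k>1$ and $F=\mathbb{R}^l$ with $l>1$, with their canonical Euclidean metrics $g_B$, $g_F$, and let $f:B\to\mathbb{R}$ be a nonzero linear function. Then the degenerate warped product $B\times_f F$, that is, $B\times F$ with the metric $g=g_B+f^2g_F$, is semi-regular but not quasi-regular. Moreover the scalar part $S_{abcd}$ blows up like $1/f^2$: where $f\neq0$, $$S_{abcd}=\frac{l(l-1)\,|\operatorname{grad} f|^2}{2(k+l)(k+l-1)\,f^2}\,(g\circ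 g)_{abcd},$$ and for all linearly independent $u,v$ tangent to $B$, $|S(u,v,u,v)|\to\infty$ at every point where $f=0$ (approached through points where $f\ne 0$). -/

import Mathlib

open scoped ContDiff Topology Gradient

noncomputable section

namespace SingularGeometry

variable {E : Type*} [NormedAddCommGroup E] [NormedSpace ℝ E]

/-- A singular semi-Riemannian metric on the manifold `E` (a normed space, with `T_p E = E`): a
smooth field of symmetric bilinear forms, which may be degenerate and of variable signature. The
linear map `g p : E → E*` is the morphism `♭` at `p`. -/
structure SingularMetric (E : Type*) [NormedAddCommGroup E] [NormedSpace ℝ E] where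
  toFun : E → E →L[ℝ] E →L[ℝ] ℝ
  symm' : ∀ p v w, toFun p v w = toFun p w v
  smooth' : ContDiff ℝ ∞ toFun

instance : CoeFun (SingularMetric E) (fun _ => E → E →L[ℝ] E →L[ℝ] ℝ) := ⟨SingularMetric.toFun⟩

/-- The metric is non-degenerate at `p`. -/
def NondegenerateAt (g : SingularMetric E) (p : E) : Prop :=
  ∀ v, (∀ w, g p v w = 0) → v = 0

/-- The points around which the rank (equivalently, the signature) of the metric is constant. They
form an open dense set, which contains all points where the metric is non-degenerate. -/
def constantSignatureSet (g : SingularMetric E) : Set E :=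
  {p | ∀ᶠ q in 𝓝 p,
    Module.finrank ℝ (g q : E →ₗ[ℝ] (E →L[ℝ] ℝ)).range =
      Module.finrank ℝ (g p : E →ₗ[ℝ] (E →L[ℝ] ℝ)).range}

/-- The function `α : E → ℝ` is a covector of the form `v ↦ b u v`, that is, it is in `♭(E)`. -/
def MemFlat (b : E →L[ℝ] E →L[ℝ] ℝ) (α : E → ℝ) : Prop :=
  ∃ u, α = fun v => b u v

open Classical in
/-- The inner product on `♭(E)` induced by a symmetric bilinear form `b`:
`⟨u♭, v♭⟩ = b u v` (see `dualInner_flat`); the value is `0` outside `♭(E)`. -/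
def dualInner (b : E →L[ℝ] E →L[ℝ] ℝ) (α η : E → ℝ) : ℝ :=
  if h : MemFlat b α ∧ MemFlat b η then b h.1.choose h.2.choose else 0

theorem dualInner_flat (b : E →L[ℝ] E →L[ℝ] ℝ) (hb : ∀ v w, b v w = b w v) (u v : E) :
    dualInner b (fun w => b u w) (fun w => b v w) = b u v := by
  have h : MemFlat b (fun w => b u w) ∧ MemFlat b (fun w => b v w) := ⟨⟨u, rfl⟩, ⟨v, rfl⟩⟩
  rw [dualInner, dif_pos h]
  have h1 := h.1.choose_spec
  have h2 := h.2.choose_spec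
  rw [← congrFun h1 h.2.choose, hb u, ← congrFun h2 u, hb v u]

/-- The Koszul form `𝒦(X,Y,Z)` of three vector fields, at the point `p`. -/
def koszul (g : SingularMetric E) (X Y Z : E → E) (p : E) : ℝ :=
  1 / 2 * (fderiv ℝ (fun q => g q (Y q) (Z q)) p (X p)
    + fderiv ℝ (fun q => g q (Z q) (X q)) p (Y p)
    - fderiv ℝ (fun q => g q (X q) (Y q)) p (Z p)
    - g p (X p) (VectorField.lieBracket ℝ Y Z p)
    + g p (Y p) (VectorField.lieBracket ℝ Z X p)
    + g p (Z p) (VectorField.lieBracket ℝ X Y p))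

/-- The `1`-form `𝒦(X,Y,_)` at `p`. The Koszul form is tensorial in its third argument
(see `koszul_eq_koszulForm`), so the vector `z` may be extended by a constant vector field. -/
def koszulForm (g : SingularMetric E) (X Y : E → E) (p : E) : E → ℝ :=
  fun z => koszul g X Y (fun _ => z) p

theorem koszul_eq_koszulForm (g : SingularMetric E) {X Y Z : E → E} {p : E}
    (hX : DifferentiableAt ℝ X p) (hY : DifferentiableAt ℝ Y p) (hZ : DifferentiableAt ℝ Z p) :
    koszul g X Y Z p = koszulForm g X Y p (Z p) := by
  have hg : DifferentiableAt ℝ g.toFun p := g.smooth'.differentiable (by simp) p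
  have key : ∀ {V W : E → E}, DifferentiableAt ℝ V p → DifferentiableAt ℝ W p → ∀ v,
      fderiv ℝ (fun q => g q (V q) (W q)) p v
        = fderiv ℝ g.toFun p v (V p) (W p) + g p (fderiv ℝ V p v) (W p)
          + g p (V p) (fderiv ℝ W p v) := by
    intro V W hV hW v
    rw [fderiv_clm_apply (hg.clm_apply hV) hW, fderiv_clm_apply hg hV]
    simp
    ring
  have hc : DifferentiableAt ℝ (fun _ : E => Z p) p := differentiableAt_const _
  simp only [koszulForm, koszul, VectorField.lieBracket]
  rw [key hY hZ, key hZ hX, key hX hY, key hY hc, key hc hX]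
  simp only [map_sub, fderiv_fun_const, Pi.zero_apply, zero_apply, map_zero]
  rw [g.symm' p (fderiv ℝ Z p (Y p)) (X p)]
  ring

/-- The contraction `𝒦(X,Y,•) 𝒦(Z,T,•)` at `p`. -/
def koszulContraction (g : SingularMetric E) (X Y Z T : E → E) (p : E) : ℝ :=
  dualInner (g p) (koszulForm g X Y p) (koszulForm g Z T p)

/-- Semi-regular metrics: for all smooth local vector fields, the `1`-form `𝒦(X,Y,_)` is in
`♭(T_p M)` at every point, and the contraction `𝒦(X,Y,•) 𝒦(Z,T,•)` is smooth. As for all the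
contracted quantities, smoothness means that it extends smoothly across the points where the
signature changes (the inner product on `♭(T_p M)` itself jumps at these points). -/
def SemiRegular (g : SingularMetric E) : Prop :=
  (∀ U : Set E, IsOpen U → ∀ X Y : E → E, ContDiffOn ℝ ∞ X U → ContDiffOn ℝ ∞ Y U →
    ∀ p ∈ U, MemFlat (g p) (koszulForm g X Y p)) ∧
  (∀ U : Set E, IsOpen U → ∀ X Y Z T : E → E, ContDiffOn ℝ ∞ X U → ContDiffOn ℝ ∞ Y U →
    ContDiffOn ℝ ∞ Z U → ContDiffOn ℝ ∞ T U →
    ∃ h : E → ℝ, ContDiffOn ℝ ∞ h U ∧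
      ∀ p ∈ U ∩ constantSignatureSet g, h p = koszulContraction g X Y Z T p)

/-- The Christoffel symbols of the first kind `Γ_{abc} = 𝒦(∂_a, ∂_b, ∂_c)` in linear coordinates;
the indices stand for constant vector fields. -/
def christoffel (g : SingularMetric E) (a b c : E) (p : E) : ℝ :=
  koszul g (fun _ => a) (fun _ => b) (fun _ => c) p

/-- The Riemann curvature
`R_{abcd} = ∂_a Γ_{bcd} - ∂_b Γ_{acd} + Γ_{ac•} Γ_{bd•} - Γ_{bc•} Γ_{ad•}`. -/
def riemann (g : SingularMetric E) (p a b c d : E) : ℝ :=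
  fderiv ℝ (christoffel g b c d) p a - fderiv ℝ (christoffel g a c d) p b
    + dualInner (g p) (fun z => christoffel g a c z p) (fun z => christoffel g b d z p)
    - dualInner (g p) (fun z => christoffel g b c z p) (fun z => christoffel g a d z p)

/-- The inverse metric `g^{st}` at a point of non-degeneracy, in a basis `e` of the tangent space:
the inner products of the dual basis covectors. -/
def inverseMetric {ι : Type*} (g : SingularMetric E) (e : Module.Basis ι ℝ E) (p : E)
    (s t : ι) : ℝ :=
  dualInner (g p) (fun v => e.repr v s) (fun v => e.repr v t)

/-- The Ricci curvature `R_{ab} = g^{st} R_{asbt}` (at points of non-degeneracy). -/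
def ricci [FiniteDimensional ℝ E] (g : SingularMetric E) (p a b : E) : ℝ :=
  ∑ s, ∑ t, inverseMetric g (Module.finBasis ℝ E) p s t *
    riemann g p a (Module.finBasis ℝ E s) b (Module.finBasis ℝ E t)

/-- The scalar curvature `R = g^{st} R_{st}` (at points of non-degeneracy). -/
def scalarCurvature [FiniteDimensional ℝ E] (g : SingularMetric E) (p : E) : ℝ :=
  ∑ s, ∑ t, inverseMetric g (Module.finBasis ℝ E) p s t *
    ricci g p (Module.finBasis ℝ E s) (Module.finBasis ℝ E t)

/-- The Kulkarni-Nomizu product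
`(h ∘ k)_{abcd} = h_{ac} k_{bd} - h_{ad} k_{bc} + h_{bd} k_{ac} - h_{bc} k_{ad}`. -/
def kulkarniNomizu (h k : E → E → ℝ) (a b c d : E) : ℝ :=
  h a c * k b d - h a d * k b c + h b d * k a c - h b c * k a d

/-- The metric at `p` as a function of two vectors. -/
def metricAt (g : SingularMetric E) (p : E) : E → E → ℝ := fun v w => g p v w

/-- The scalar part `S_{abcd} = R (g ∘ g)_{abcd} / (2n(n-1))` of the Riemann curvature
(at points of non-degeneracy). -/
def scalarPart [FiniteDimensional ℝ E] (g : SingularMetric E) (p a b c d : E) : ℝ :=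
  1 / (2 * (Module.finrank ℝ E : ℝ) * ((Module.finrank ℝ E : ℝ) - 1)) * scalarCurvature g p *
    kulkarniNomizu (metricAt g p) (metricAt g p) a b c d

/-- The traceless part `S_{ab} = R_{ab} - R g_{ab} / n` of the Ricci curvature
(at points of non-degeneracy). -/
def tracelessRicci [FiniteDimensional ℝ E] (g : SingularMetric E) (p a b : E) : ℝ :=
  ricci g p a b - 1 / (Module.finrank ℝ E : ℝ) * scalarCurvature g p * g p a b

/-- The semi-traceless part `E_{abcd} = (S ∘ g)_{abcd} / (n-2)` of the Riemann curvature
(at points of non-degeneracy). -/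
def semiTracelessPart [FiniteDimensional ℝ E] (g : SingularMetric E) (p a b c d : E) : ℝ :=
  1 / ((Module.finrank ℝ E : ℝ) - 2) *
    kulkarniNomizu (tracelessRicci g p) (metricAt g p) a b c d

/-- A covariant tensor field of order four, given at the points where the metric is
non-degenerate, extends smoothly (that is, its components do) to the entire manifold. -/
def ExtendsSmoothly (g : SingularMetric E) (T : E → E → E → E → E → ℝ) : Prop :=
  ∀ a b c d : E, ∃ h : E → ℝ, ContDiff ℝ ∞ h ∧ ∀ p, NondegenerateAt g p → h p = T p a b c d

/-- Quasi-regular metrics. -/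
def QuasiRegular [FiniteDimensional ℝ E] (g : SingularMetric E) : Prop :=
  SemiRegular g ∧ Dense {p | NondegenerateAt g p} ∧
    ExtendsSmoothly g (scalarPart g) ∧ ExtendsSmoothly g (semiTracelessPart g)

/-- The degenerate warped product `B ×_f F`: the manifold `B × F` with the metric
`g_B + f² g_F`. The warping function may vanish. -/
def warpedProduct {B F : Type*} [NormedAddCommGroup B] [NormedSpace ℝ B] [FiniteDimensional ℝ B]
    [NormedAddCommGroup F] [NormedSpace ℝ F] [FiniteDimensional ℝ F]
    (gB : SingularMetric B) (gF : SingularMetric F) (f : B → ℝ) (hf : ContDiff ℝ ∞ f) :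
    SingularMetric (B × F) where
  toFun p :=
    (gB p.1).bilinearComp (ContinuousLinearMap.fst ℝ B F) (ContinuousLinearMap.fst ℝ B F) +
      (f p.1) ^ 2 •
        (gF p.2).bilinearComp (ContinuousLinearMap.snd ℝ B F) (ContinuousLinearMap.snd ℝ B F)
  symm' p v w := by
    simp [gB.symm' p.1 v.1 w.1, gF.symm' p.2 v.2 w.2]
  smooth' := by
    refine contDiff_clm_apply_iff.2 fun v => contDiff_clm_apply_iff.2 fun w => ?_
    have hB : ContDiff ℝ ∞ fun p : B × F => gB p.1 v.1 w.1 :=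
      ((gB.smooth'.comp contDiff_fst).clm_apply contDiff_const).clm_apply contDiff_const
    have hF : ContDiff ℝ ∞ fun p : B × F => gF p.2 v.2 w.2 :=
      ((gF.smooth'.comp contDiff_snd).clm_apply contDiff_const).clm_apply contDiff_const
    have hf' : ContDiff ℝ ∞ fun p : B × F => f p.1 := hf.comp contDiff_fst
    simpa using hB.add ((hf'.pow 2).mul hF)

/-- The canonical metric of the Euclidean space `ℝⁿ`. -/
def euclideanMetric (n : ℕ) : SingularMetric (EuclideanSpace ℝ (Fin n)) where
  toFun _ := innerSL ℝ
  symm' _ v w := real_inner_comm w v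
  smooth' := contDiff_const

theorem contDiff_linearMap [FiniteDimensional ℝ E] (f : E →ₗ[ℝ] ℝ) : ContDiff ℝ ∞ f :=
  (LinearMap.toContinuousLinearMap f).contDiff

/-- The degenerate warped product `ℝᵏ ×_f ℝˡ` of Euclidean spaces with a linear warping
function. -/
def euclideanWarped (k l : ℕ) (f : EuclideanSpace ℝ (Fin k) →ₗ[ℝ] ℝ) :
    SingularMetric (EuclideanSpace ℝ (Fin k) × EuclideanSpace ℝ (Fin l)) :=
  warpedProduct (euclideanMetric k) (euclideanMetric l) f (contDiff_linearMap f)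

end SingularGeometry

end

namespace SingularGeometry

/-! ### Koszul form and metric traces for an arbitrary singular metric -/

section General

variable {E : Type*} [NormedAddCommGroup E] [NormedSpace ℝ E]

/-! Since `f` is linear, `grad f` is constant and the metric depends on the point only through `f²`.
Every Christoffel symbol therefore carries a factor `f`. Raising the index of `𝒦(X,Y,_)` costs `f⁻²`
on the fibre, so the representing vector has only a `1/f` pole, and the weight `f²` of the metric
cancels the two poles in a contraction. This gives semi-regularity
(`euclideanWarped_covariantDerivativeVector_self`).

The base is flat and `f` has no second derivative, so the curvature lives on the fibre and equals
`f² |grad f|²` times the constant-curvature tensor of `g_F`. One trace absorbs `f²`; the second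
leaves `R = l(l-1)|grad f|²/f²`. On a plane of the base `g ∘ g` is independent of `f`, so nothing
compensates this pole and the scalar part has no continuous extension. -/

theorem SingularMetric.differentiable (g : SingularMetric E) : Differentiable ℝ g.toFun :=
  g.smooth'.differentiable (by simp)

theorem SingularMetric.fderiv_apply_fields (g : SingularMetric E) {V W : E → E} {p : E}
    (hV : DifferentiableAt ℝ V p) (hW : DifferentiableAt ℝ W p) (v : E) :
    fderiv ℝ (fun q => g q (V q) (W q)) p v
      = fderiv ℝ g.toFun p v (V p) (W p) + g p (fderiv ℝ V p v) (W p)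
        + g p (V p) (fderiv ℝ W p v) := by
  have hg := g.differentiable p
  rw [fderiv_clm_apply (hg.clm_apply hV) hW, fderiv_clm_apply hg hV]
  simp
  ring

/-- The Christoffel symbols in terms of the derivative of the metric. -/
theorem christoffel_eq_fderiv (g : SingularMetric E) (a b c p : E) :
    christoffel g a b c p = 1 / 2 * (fderiv ℝ g.toFun p a b c + fderiv ℝ g.toFun p b c a
      - fderiv ℝ g.toFun p c a b) := by
  have hc : ∀ v : E, DifferentiableAt ℝ (fun _ : E => v) p := fun v => differentiableAt_const _
  simp only [christoffel, koszul, VectorField.lieBracket]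
  rw [g.fderiv_apply_fields (hc b) (hc c), g.fderiv_apply_fields (hc c) (hc a),
    g.fderiv_apply_fields (hc a) (hc b)]
  simp

/-- The derivatives of `X` cancel against the Lie brackets; the only derivative left, that of `Y`
along `X`, enters as a form already in the image of `♭`. -/
theorem koszulForm_eq_christoffel (g : SingularMetric E) {X Y : E → E} {p : E}
    (hX : DifferentiableAt ℝ X p) (hY : DifferentiableAt ℝ Y p) (z : E) :
    koszulForm g X Y p z = g p (fderiv ℝ Y p (X p)) z + christoffel g (X p) (Y p) z p := by
  have hc : DifferentiableAt ℝ (fun _ : E => z) p := differentiableAt_const _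
  rw [christoffel_eq_fderiv]
  simp only [koszulForm, koszul, VectorField.lieBracket]
  rw [g.fderiv_apply_fields hY hc, g.fderiv_apply_fields hc hX, g.fderiv_apply_fields hX hY]
  simp only [map_sub, fderiv_fun_const, Pi.zero_apply, zero_apply, map_zero]
  rw [g.symm' p (fderiv ℝ X p z) (Y p), g.symm' p z (fderiv ℝ X p (Y p)),
    g.symm' p z (fderiv ℝ Y p (X p))]
  ring

/-- At a point of non-degeneracy, the morphism `♭` is onto the dual space. -/
theorem NondegenerateAt.exists_eq [FiniteDimensional ℝ E] {g : SingularMetric E} {p : E}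
    (h : NondegenerateAt g p) (α : E →ₗ[ℝ] ℝ) : ∃ u, ∀ v, g p u v = α v := by
  let L : E →ₗ[ℝ] (E →ₗ[ℝ] ℝ) :=
    { toFun := fun u => (g p u : E →ₗ[ℝ] ℝ)
      map_add' := fun u v => by ext; simp
      map_smul' := fun c u => by ext; simp }
  have hL : Function.Injective L := by
    rw [injective_iff_map_eq_zero]
    exact fun u hu => h u fun w => LinearMap.congr_fun hu w
  obtain ⟨u, hu⟩ := (LinearMap.injective_iff_surjective_of_finrank_eq_finrank
    (Subspace.dual_finrank_eq (K := ℝ) (V := E)).symm).1 hL α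
  exact ⟨u, fun v => LinearMap.congr_fun hu v⟩

/-- The contraction of a bilinear form `T` with the inverse metric is the trace of the
endomorphism that represents `T`. -/
theorem sum_inverseMetric_mul [FiniteDimensional ℝ E] {ι : Type*} [Fintype ι]
    (g : SingularMetric E) (e : Module.Basis ι ℝ E) {p : E} (h : NondegenerateAt g p)
    (A : E →ₗ[ℝ] E) :
    ∑ s, ∑ t, inverseMetric g e p s t * g p (e s) (A (e t)) = LinearMap.trace ℝ E A := by
  classical
  -- `u s` is the vector whose `♭` is the dual covector of `e s`, so the inverse metric is the
  -- coordinate matrix of these vectors.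
  choose u hu using fun s => h.exists_eq (e.coord s)
  have hinv : ∀ s t, inverseMetric g e p s t = e.repr (u t) s := by
    intro s t
    have h1 : ∀ s, (fun v => e.repr v s) = fun v => g p (u s) v := fun s => by
      ext v; rw [hu]; rfl
    rw [inverseMetric, h1 s, h1 t, dualInner_flat _ (g.symm' p), hu]
    rfl
  rw [Finset.sum_comm, LinearMap.trace_eq_matrix_trace ℝ e, Matrix.trace]
  refine Finset.sum_congr rfl fun t _ => ?_
  have h2 : ∑ s, inverseMetric g e p s t * g p (e s) (A (e t)) = g p (u t) (A (e t)) := by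
    conv_rhs => rw [← e.sum_repr (u t)]
    simp only [hinv, map_sum, map_smul, sum_apply,
      smul_apply, smul_eq_mul]
  rw [h2, hu, Matrix.diag_apply, LinearMap.toMatrix_apply]
  rfl

end General

/-! ### Metric and connection of the warped product -/

section Warped

open Filter

variable {k l : ℕ} {f : EuclideanSpace ℝ (Fin k) →ₗ[ℝ] ℝ}

local notation "B" => EuclideanSpace ℝ (Fin k)
local notation "F" => EuclideanSpace ℝ (Fin l)
local notation "⟪" x "," y "⟫" => inner ℝ x y

theorem euclideanWarped_apply (p v w : B × F) :
    euclideanWarped k l f p v w = ⟪v.1, w.1⟫ + f p.1 ^ 2 * ⟪v.2, w.2⟫ := by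
  simp only [euclideanWarped, warpedProduct, euclideanMetric, add_apply,
    smul_apply, ContinuousLinearMap.bilinearComp_apply, smul_eq_mul]
  rfl

theorem inner_gradient_linearMap (x y : B) : ⟪∇ f x, y⟫ = f y := by
  rw [inner_gradient_left]
  have := (LinearMap.toContinuousLinearMap f).fderiv (x := x)
  rw [LinearMap.coe_toContinuousLinearMap'] at this
  rw [this]
  simp

theorem gradient_linearMap (x y : B) : ∇ f x = ∇ f y :=
  ext_inner_right ℝ fun v => by rw [inner_gradient_linearMap, inner_gradient_linearMap]

theorem linearMap_gradient (x y : B) : f (∇ f x) = ‖∇ f y‖ ^ 2 := by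
  rw [gradient_linearMap x y, ← inner_gradient_linearMap y, real_inner_self_eq_norm_sq]

theorem hasFDerivAt_fst (p : B × F) :
    HasFDerivAt (fun q : B × F => f q.1)
      (LinearMap.toContinuousLinearMap f ∘L ContinuousLinearMap.fst ℝ B F) p :=
  (LinearMap.toContinuousLinearMap f ∘L ContinuousLinearMap.fst ℝ B F).hasFDerivAt

theorem fderiv_euclideanWarped (p v a b : B × F) :
    fderiv ℝ (euclideanWarped k l f).toFun p v a b = 2 * f p.1 * f v.1 * ⟪a.2, b.2⟫ := by
  have h := (euclideanWarped k l f).fderiv_apply_fields (p := p)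
    (differentiableAt_const a) (differentiableAt_const b) v
  simp only [fderiv_fun_const, Pi.zero_apply, zero_apply, map_zero, add_zero,
    euclideanWarped_apply] at h
  rw [← h, ((((hasFDerivAt_fst p).pow 2).mul_const ⟪a.2, b.2⟫).const_add ⟪a.1, b.1⟫).fderiv]
  simp
  ring

theorem christoffel_euclideanWarped (a b c p : B × F) :
    christoffel (euclideanWarped k l f) a b c p =
      f p.1 * (f a.1 * ⟪b.2, c.2⟫ + f b.1 * ⟪a.2, c.2⟫ - f c.1 * ⟪a.2, b.2⟫) := by
  simp only [christoffel_eq_fderiv, fderiv_euclideanWarped]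
  rw [real_inner_comm a.2 c.2]
  ring

theorem fderiv_christoffel_euclideanWarped (a b c p v : B × F) :
    fderiv ℝ (christoffel (euclideanWarped k l f) a b c) p v =
      f v.1 * (f a.1 * ⟪b.2, c.2⟫ + f b.1 * ⟪a.2, c.2⟫ - f c.1 * ⟪a.2, b.2⟫) := by
  rw [funext (christoffel_euclideanWarped a b c), ((hasFDerivAt_fst p).mul_const _).fderiv]
  simp
  ring

/-- For `f p ≠ 0`, the vector field `∇_X Y` at `p`, where `x`, `y` are the values of `X`, `Y` and
`d` is the derivative of the components of `Y` in the direction `x`. -/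
noncomputable def covariantDerivativeVector (f : B →ₗ[ℝ] ℝ) (p x y d : B × F) : B × F :=
  (d.1 - (f p.1 * ⟪x.2, y.2⟫) • ∇ f 0,
    (f p.1)⁻¹ • (f p.1 • d.2 + f x.1 • y.2 + f y.1 • x.2))

theorem euclideanWarped_covariantDerivativeVector (p x y d z : B × F) :
    euclideanWarped k l f p (covariantDerivativeVector f p x y d) z =
      euclideanWarped k l f p d z + christoffel (euclideanWarped k l f) x y z p := by
  -- True also at `f = 0`, where the inverse is `0`. Hence the representation, and with it
  -- membership in `♭`, persists at degenerate points.
  have h : f p.1 ^ 2 * (f p.1)⁻¹ = f p.1 := by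
    rcases eq_or_ne (f p.1) 0 with h | h
    · simp [h]
    · field_simp
  rw [euclideanWarped_apply, euclideanWarped_apply, christoffel_euclideanWarped]
  simp only [covariantDerivativeVector, inner_sub_left, inner_add_left, real_inner_smul_left,
    inner_gradient_linearMap]
  rw [← mul_assoc, h]
  ring

/-! ### Semi-regularity -/

theorem koszulForm_euclideanWarped {X Y : B × F → B × F} {p : B × F}
    (hX : DifferentiableAt ℝ X p) (hY : DifferentiableAt ℝ Y p) :
    koszulForm (euclideanWarped k l f) X Y p = fun z => euclideanWarped k l f p
      (covariantDerivativeVector f p (X p) (Y p) (fderiv ℝ Y p (X p))) z := by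
  ext z
  rw [koszulForm_eq_christoffel _ hX hY, euclideanWarped_covariantDerivativeVector]

/-- The right-hand side contains no inverse of `f`: it serves as the smooth extension of the
contraction across `f = 0`. -/
theorem euclideanWarped_covariantDerivativeVector_self {p : B × F} (hp : f p.1 ≠ 0)
    (x y d x' y' d' : B × F) :
    euclideanWarped k l f p (covariantDerivativeVector f p x y d)
        (covariantDerivativeVector f p x' y' d') =
      ⟪d.1 - (f p.1 * ⟪x.2, y.2⟫) • ∇ f 0, d'.1 - (f p.1 * ⟪x'.2, y'.2⟫) • ∇ f 0⟫ +
      ⟪f p.1 • d.2 + f x.1 • y.2 + f y.1 • x.2,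
        f p.1 • d'.2 + f x'.1 • y'.2 + f y'.1 • x'.2⟫ := by
  rw [euclideanWarped_apply]
  simp only [covariantDerivativeVector, real_inner_smul_left, real_inner_smul_right]
  field_simp

theorem nondegenerateAt_euclideanWarped {p : B × F} (hp : f p.1 ≠ 0) :
    NondegenerateAt (euclideanWarped k l f) p := by
  intro v hv
  have h1 := hv (v.1, 0)
  have h2 := hv (0, v.2)
  simp only [euclideanWarped_apply, inner_zero_right, mul_zero, add_zero, zero_add,
    inner_self_eq_zero, mul_eq_zero, pow_eq_zero_iff, ne_eq, OfNat.ofNat_ne_zero,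
    not_false_eq_true, hp, false_or] at h1 h2
  exact Prod.ext h1 h2

theorem frequently_linearMap_ne_zero (hf : f ≠ 0) (p : B × F) : ∃ᶠ q in 𝓝 p, f q.1 ≠ 0 := by
  obtain ⟨v, hv⟩ : ∃ v, f v ≠ 0 := by
    by_contra! h
    exact hf (LinearMap.ext h)
  by_cases hp : f p.1 = 0
  · have ht : Tendsto (fun t : ℝ => p + t • ((v, 0) : B × F)) (𝓝[≠] 0) (𝓝 p) := by
      have : Continuous (fun t : ℝ => p + t • ((v, 0) : B × F)) := by fun_prop
      simpa using (this.tendsto 0).mono_left nhdsWithin_le_nhds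
    refine ht.frequently (Eventually.frequently ?_)
    filter_upwards [self_mem_nhdsWithin] with t ht
    simpa [hp, hv] using ht
  · exact (((hasFDerivAt_fst p).continuousAt).eventually_ne hp).frequently

/-- Points of full rank accumulate everywhere, so locally constant rank forces full rank; but where
`f = 0` the fibre directions lie in the kernel. -/
theorem linearMap_ne_zero_of_mem_constantSignatureSet (hl : 0 < l) (hf : f ≠ 0) {p : B × F}
    (hp : p ∈ constantSignatureSet (euclideanWarped k l f)) : f p.1 ≠ 0 := by
  obtain ⟨q, hq, hr⟩ := ((frequently_linearMap_ne_zero hf p).and_eventually hp).exists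
  intro h0
  have hinj : Function.Injective (euclideanWarped k l f q : B × F →ₗ[ℝ] (B × F →L[ℝ] ℝ)) := by
    rw [injective_iff_map_eq_zero]
    exact fun u hu => nondegenerateAt_euclideanWarped hq u fun w => DFunLike.congr_fun hu w
  rw [LinearMap.finrank_range_of_inj hinj] at hr
  have hker := LinearMap.finrank_range_add_finrank_ker
    (euclideanWarped k l f p : B × F →ₗ[ℝ] (B × F →L[ℝ] ℝ))
  rw [← hr] at hker
  have hbot : (euclideanWarped k l f p : B × F →ₗ[ℝ] (B × F →L[ℝ] ℝ)).ker = ⊥ :=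
    Submodule.finrank_eq_zero.1 (by omega)
  let e : F := EuclideanSpace.single ⟨0, hl⟩ 1
  have he : ((0, e) : B × F) ∈
      (euclideanWarped k l f p : B × F →ₗ[ℝ] (B × F →L[ℝ] ℝ)).ker := by
    rw [LinearMap.mem_ker]
    ext z <;> simp [euclideanWarped_apply, h0]
  rw [hbot, Submodule.mem_bot, Prod.mk_eq_zero] at he
  have := congrArg norm he.2
  simp [e] at this

theorem semiRegular_euclideanWarped (hl : 0 < l) (hf : f ≠ 0) :
    SemiRegular (euclideanWarped k l f) := by
  have hd : ∀ {U : Set (B × F)} {X : B × F → B × F}, IsOpen U → ContDiffOn ℝ ∞ X U →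
      ∀ p ∈ U, DifferentiableAt ℝ X p := fun hU hX p hp =>
    (hX.contDiffAt (hU.mem_nhds hp)).differentiableAt (by simp)
  constructor
  · intro U hU X Y hX hY p hp
    exact ⟨_, koszulForm_euclideanWarped (hd hU hX p hp) (hd hU hY p hp)⟩
  · intro U hU X Y Z T hX hY hZ hT
    have hD : ∀ {X Y : B × F → B × F}, ContDiffOn ℝ ∞ X U → ContDiffOn ℝ ∞ Y U →
        ContDiffOn ℝ ∞ (fun p => fderiv ℝ Y p (X p)) U := fun hX hY =>
      (hY.fderiv_of_isOpen hU (by simp)).clm_apply hX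
    have hf' : ∀ {W : B × F → B × F}, ContDiffOn ℝ ∞ W U →
        ContDiffOn ℝ ∞ (fun p => f (W p).1) U := fun hW =>
      (contDiff_linearMap f).comp_contDiffOn hW.fst
    have hfp := hf' (contDiffOn_id (s := U))
    have hb : ∀ {X Y : B × F → B × F}, ContDiffOn ℝ ∞ X U → ContDiffOn ℝ ∞ Y U →
        ContDiffOn ℝ ∞ (fun p => (fderiv ℝ Y p (X p)).1
          - (f p.1 * ⟪(X p).2, (Y p).2⟫) • ∇ f 0) U := fun hX hY =>
      (hD hX hY).fst.sub ((hfp.mul (hX.snd.inner ℝ hY.snd)).smul contDiffOn_const)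
    have hw : ∀ {X Y : B × F → B × F}, ContDiffOn ℝ ∞ X U → ContDiffOn ℝ ∞ Y U →
        ContDiffOn ℝ ∞ (fun p => f p.1 • (fderiv ℝ Y p (X p)).2
          + f (X p).1 • (Y p).2 + f (Y p).1 • (X p).2) U := fun hX hY =>
      ((hfp.smul (hD hX hY).snd).add ((hf' hX).smul hY.snd)).add ((hf' hY).smul hX.snd)
    refine ⟨_, ((hb hX hY).inner ℝ (hb hZ hT)).add ((hw hX hY).inner ℝ (hw hZ hT)), ?_⟩
    rintro p ⟨hp, hs⟩
    have h0 := linearMap_ne_zero_of_mem_constantSignatureSet hl hf hs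
    rw [koszulContraction, koszulForm_euclideanWarped (hd hU hX p hp) (hd hU hY p hp),
      koszulForm_euclideanWarped (hd hU hZ p hp) (hd hU hT p hp),
      dualInner_flat _ ((euclideanWarped k l f).symm' p),
      euclideanWarped_covariantDerivativeVector_self h0]

/-! ### Curvature where the metric is non-degenerate -/

theorem dualInner_christoffel_euclideanWarped {p : B × F} (hp : f p.1 ≠ 0) (a b c d : B × F) :
    dualInner (euclideanWarped k l f p)
        (fun z => christoffel (euclideanWarped k l f) a b z p)
        (fun z => christoffel (euclideanWarped k l f) c d z p) =
      f p.1 ^ 2 * ‖∇ f p.1‖ ^ 2 * (⟪a.2, b.2⟫ * ⟪c.2, d.2⟫) +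
        ⟪f a.1 • b.2 + f b.1 • a.2, f c.1 • d.2 + f d.1 • c.2⟫ := by
  have h : ∀ a b : B × F, (fun z => christoffel (euclideanWarped k l f) a b z p) =
      fun z => euclideanWarped k l f p (covariantDerivativeVector f p a b 0) z := fun a b => by
    ext z
    simp [euclideanWarped_covariantDerivativeVector]
  rw [h a b, h c d, dualInner_flat _ ((euclideanWarped k l f).symm' p),
    euclideanWarped_covariantDerivativeVector_self hp]
  simp only [Prod.fst_zero, Prod.snd_zero, smul_zero, zero_sub, zero_add, inner_neg_neg,
    real_inner_smul_left, real_inner_smul_right, inner_gradient_linearMap, linearMap_gradient 0 p.1]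
  ring

/-- The derivative terms cancel against the fibre part of the quadratic terms; only the base part,
proportional to `|grad f|²`, survives. -/
theorem riemann_euclideanWarped {p : B × F} (hp : f p.1 ≠ 0) (a b c d : B × F) :
    riemann (euclideanWarped k l f) p a b c d =
      f p.1 ^ 2 * ‖∇ f p.1‖ ^ 2 * (⟪a.2, c.2⟫ * ⟪b.2, d.2⟫ - ⟪b.2, c.2⟫ * ⟪a.2, d.2⟫) := by
  rw [riemann, fderiv_christoffel_euclideanWarped, fderiv_christoffel_euclideanWarped,
    dualInner_christoffel_euclideanWarped hp, dualInner_christoffel_euclideanWarped hp]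
  simp only [inner_add_left, inner_add_right, real_inner_smul_left, real_inner_smul_right]
  rw [real_inner_comm b.2 c.2, real_inner_comm a.2 c.2, real_inner_comm a.2 b.2]
  ring

theorem ricci_euclideanWarped {p : B × F} (hp : f p.1 ≠ 0) (a b : B × F) :
    ricci (euclideanWarped k l f) p a b = ((l : ℝ) - 1) * ‖∇ f p.1‖ ^ 2 * ⟪a.2, b.2⟫ := by
  -- The fibre endomorphism representing `R(a, ·, b, ·)`; the factor `f²` of the curvature is
  -- absorbed by the metric.
  let A : F →ₗ[ℝ] F := ‖∇ f p.1‖ ^ 2 • (⟪a.2, b.2⟫ • LinearMap.id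
    - ((innerSL ℝ a.2 : F →L[ℝ] ℝ) : F →ₗ[ℝ] ℝ).smulRight b.2)
  have hA : ∀ s t : B × F, riemann (euclideanWarped k l f) p a s b t =
      euclideanWarped k l f p s ((0 : B →ₗ[ℝ] B).prodMap A t) := fun s t => by
    rw [riemann_euclideanWarped hp, euclideanWarped_apply]
    simp [A, inner_sub_right, real_inner_smul_right]
    ring
  simp only [ricci, hA]
  rw [sum_inverseMetric_mul _ _ (nondegenerateAt_euclideanWarped hp), LinearMap.trace_prodMap',
    map_zero, zero_add, LinearMap.trace_eq_sum_inner A (EuclideanSpace.basisFun (Fin l) ℝ)]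
  have h1 := (EuclideanSpace.basisFun (Fin l) ℝ).sum_inner_mul_inner a.2 b.2
  have h2 : ∀ i, ⟪EuclideanSpace.basisFun (Fin l) ℝ i, A (EuclideanSpace.basisFun (Fin l) ℝ i)⟫ =
      ‖∇ f p.1‖ ^ 2 * (⟪a.2, b.2⟫ - ⟪a.2, EuclideanSpace.basisFun (Fin l) ℝ i⟫ *
        ⟪EuclideanSpace.basisFun (Fin l) ℝ i, b.2⟫) := fun i => by
    have h3 : ⟪EuclideanSpace.basisFun (Fin l) ℝ i, EuclideanSpace.basisFun (Fin l) ℝ i⟫ = 1 := by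
      rw [real_inner_self_eq_norm_sq, OrthonormalBasis.norm_eq_one, one_pow]
    simp only [A, LinearMap.smul_apply, LinearMap.sub_apply, LinearMap.id_apply,
      LinearMap.smulRight_apply, ContinuousLinearMap.coe_coe, innerSL_apply_apply, inner_sub_right,
      real_inner_smul_right, h3]
    ring
  rw [Finset.sum_congr rfl fun i _ => h2 i, ← Finset.mul_sum, Finset.sum_sub_distrib, h1]
  simp
  ring

theorem scalarCurvature_euclideanWarped {p : B × F} (hp : f p.1 ≠ 0) :
    scalarCurvature (euclideanWarped k l f) p =
      (l : ℝ) * ((l : ℝ) - 1) * ‖∇ f p.1‖ ^ 2 / f p.1 ^ 2 := by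
  -- The Ricci form has no factor `f²`, so representing it through the metric costs `f⁻²`: this is
  -- the source of the pole.
  let A : F →ₗ[ℝ] F := (((l : ℝ) - 1) * ‖∇ f p.1‖ ^ 2 / f p.1 ^ 2) • LinearMap.id
  have hA : ∀ s t : B × F, ricci (euclideanWarped k l f) p s t =
      euclideanWarped k l f p s ((0 : B →ₗ[ℝ] B).prodMap A t) := fun s t => by
    rw [ricci_euclideanWarped hp, euclideanWarped_apply]
    simp [A, real_inner_smul_right]
    field_simp
  simp only [scalarCurvature, hA]
  rw [sum_inverseMetric_mul _ _ (nondegenerateAt_euclideanWarped hp), LinearMap.trace_prodMap',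
    map_zero, zero_add]
  simp [A, LinearMap.trace_id]
  ring

theorem scalarPart_euclideanWarped {p : B × F} (hp : f p.1 ≠ 0) (a b c d : B × F) :
    scalarPart (euclideanWarped k l f) p a b c d =
      (l : ℝ) * ((l : ℝ) - 1) * ‖∇ f p.1‖ ^ 2 /
          (2 * ((k : ℝ) + l) * ((k : ℝ) + l - 1) * f p.1 ^ 2) *
        kulkarniNomizu (metricAt (euclideanWarped k l f) p)
          (metricAt (euclideanWarped k l f) p) a b c d := by
  rw [scalarPart, scalarCurvature_euclideanWarped hp]
  simp only [Module.finrank_prod, finrank_euclideanSpace, Fintype.card_fin, Nat.cast_add,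
    div_eq_mul_inv, mul_inv]
  ring

/-! ### Blow-up of the scalar part -/

theorem real_inner_mul_inner_lt_of_linearIndependent {V : Type*} [NormedAddCommGroup V]
    [InnerProductSpace ℝ V] {u v : V} (h : LinearIndependent ℝ ![u, v]) :
    ⟪u, v⟫ * ⟪u, v⟫ < ⟪u, u⟫ * ⟪v, v⟫ := by
  rw [LinearIndependent.pair_iff] at h
  have hu : u ≠ 0 := by
    rintro rfl
    simpa using (h 1 0 (by simp)).1
  have huu : 0 < ⟪u, u⟫ := real_inner_self_pos.2 hu
  -- This vector is orthogonal to `u`; its squared norm is `⟪u, u⟫` times the Gram determinant.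
  have hw : -⟪u, v⟫ • u + ⟪u, u⟫ • v ≠ 0 := fun h0 => huu.ne' (h _ _ h0).2
  have hpos := real_inner_self_pos.2 hw
  simp only [inner_add_left, inner_add_right, real_inner_smul_left, real_inner_smul_right,
    real_inner_comm u v] at hpos
  have : 0 < ⟪u, u⟫ * (⟪u, u⟫ * ⟪v, v⟫ - ⟪u, v⟫ * ⟪u, v⟫) := by
    linarith
  exact sub_pos.1 (pos_of_mul_pos_right this huu.le)

theorem tendsto_abs_scalarPart_euclideanWarped (hk : 0 < k) (hl : 1 < l) (hf : f ≠ 0)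
    {p₀ : B × F} (hp₀ : f p₀.1 = 0) {u v : B} (huv : LinearIndependent ℝ ![u, v]) :
    Tendsto (fun p => |scalarPart (euclideanWarped k l f) p (u, 0) (v, 0) (u, 0) (v, 0)|)
      (𝓝[{p | f p.1 ≠ 0}] p₀) atTop := by
  have hN : 0 < ‖∇ f 0‖ ^ 2 := by
    refine pow_pos (norm_pos_iff.2 fun h => hf (LinearMap.ext fun y => ?_)) 2
    rw [← inner_gradient_linearMap 0 y, h, inner_zero_left, LinearMap.zero_apply]
  have hG := sub_pos.2 (real_inner_mul_inner_lt_of_linearIndependent huv)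
  have hk' : (0 : ℝ) < k := by exact_mod_cast hk
  have hl' : (1 : ℝ) < l := by exact_mod_cast hl
  -- The coefficient of `f⁻²`: on the base plane `g ∘ g` is twice the Gram determinant, which
  -- cancels the `2` in the denominator.
  have hc : 0 < (l : ℝ) * ((l : ℝ) - 1) * ‖∇ f 0‖ ^ 2 /
      (((k : ℝ) + l) * ((k : ℝ) + l - 1)) * (⟪u, u⟫ * ⟪v, v⟫ - ⟪u, v⟫ * ⟪u, v⟫) := by
    have h1 : 0 < (l : ℝ) - 1 := by linarith
    have h2 : 0 < (k : ℝ) + l - 1 := by linarith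
    positivity
  have hlim : Tendsto (fun p : B × F => (f p.1 ^ 2)⁻¹) (𝓝[{p | f p.1 ≠ 0}] p₀) atTop := by
    refine tendsto_inv_nhdsGT_zero.comp (tendsto_nhdsWithin_iff.2 ⟨?_, ?_⟩)
    · have := ((hasFDerivAt_fst (f := f) p₀).continuousAt.tendsto).pow 2
      rw [hp₀, zero_pow two_ne_zero] at this
      exact this.mono_left nhdsWithin_le_nhds
    · filter_upwards [self_mem_nhdsWithin] with p hp
      exact sq_pos_of_ne_zero hp
  refine (hlim.const_mul_atTop hc).congr' ?_
  filter_upwards [self_mem_nhdsWithin] with p hp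
  have h2 : scalarPart (euclideanWarped k l f) p (u, 0) (v, 0) (u, 0) (v, 0) =
      (l : ℝ) * ((l : ℝ) - 1) * ‖∇ f 0‖ ^ 2 /
      (((k : ℝ) + l) * ((k : ℝ) + l - 1)) * (⟪u, u⟫ * ⟪v, v⟫ - ⟪u, v⟫ * ⟪u, v⟫) *
      (f p.1 ^ 2)⁻¹ := by
    rw [scalarPart_euclideanWarped hp, gradient_linearMap p.1 0]
    simp only [kulkarniNomizu, metricAt, euclideanWarped_apply, inner_zero_left, mul_zero,
      add_zero, real_inner_comm u v, div_eq_mul_inv, mul_inv]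
    ring
  rw [h2, abs_of_pos (mul_pos hc (inv_pos.2 (by positivity)))]

theorem not_quasiRegular_euclideanWarped (hk : 1 < k) (hl : 1 < l) (hf : f ≠ 0) :
    ¬ QuasiRegular (euclideanWarped k l f) := by
  rintro ⟨-, -, hS, -⟩
  let e := (EuclideanSpace.basisFun (Fin k) ℝ).toBasis
  let i : Fin k := ⟨0, by omega⟩
  let j : Fin k := ⟨1, hk⟩
  have huv : LinearIndependent ℝ ![e i, e j] := by
    have hij : Function.Injective ![i, j] := by
      intro x y
      fin_cases x <;> fin_cases y <;> simp [i, j]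
    have heq : ![e i, e j] = e ∘ ![i, j] := by
      ext x
      fin_cases x <;> rfl
    rw [heq]
    exact e.linearIndependent.comp _ hij
  obtain ⟨h, hh, hS⟩ := hS (e i, 0) (e j, 0) (e i, 0) (e j, 0)
  have h1 := tendsto_abs_scalarPart_euclideanWarped (p₀ := (0 : B × F)) (by omega) hl hf
    (by simp) huv
  have h2 : Tendsto (fun p => |h p|) (𝓝[{p : B × F | f p.1 ≠ 0}] 0) (𝓝 |h 0|) :=
    (hh.continuous.abs.tendsto 0).mono_left nhdsWithin_le_nhds
  -- Density of `f ≠ 0` makes the filter proper, so divergence of the scalar part contradicts the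
  -- finite limit of the extension `h`.
  have : (𝓝[{p : B × F | f p.1 ≠ 0}] (0 : B × F)).NeBot :=
    mem_closure_iff_nhdsWithin_neBot.1
      (mem_closure_iff_frequently.2 (frequently_linearMap_ne_zero hf 0))
  refine not_tendsto_nhds_of_tendsto_atTop h1 _ (h2.congr' ?_)
  filter_upwards [self_mem_nhdsWithin] with p hp
  rw [hS p (nondegenerateAt_euclideanWarped hp)]

end Warped

end SingularGeometry

theorem mainTheorem3 (k l : ℕ) (hk : 1 < k) (hl : 1 < l)
    (f : EuclideanSpace ℝ (Fin k) →ₗ[ℝ] ℝ) (hf : f ≠ 0) :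
    SingularGeometry.SemiRegular (SingularGeometry.euclideanWarped k l f) ∧
    ¬ SingularGeometry.QuasiRegular (SingularGeometry.euclideanWarped k l f) ∧
    -- the scalar part, where `f ≠ 0`
    (∀ p : EuclideanSpace ℝ (Fin k) × EuclideanSpace ℝ (Fin l), f p.1 ≠ 0 →
      ∀ a b c d : EuclideanSpace ℝ (Fin k) × EuclideanSpace ℝ (Fin l),
        SingularGeometry.scalarPart (SingularGeometry.euclideanWarped k l f) p a b c d =
          (l : ℝ) * ((l : ℝ) - 1) * ‖gradient f p.1‖ ^ 2 /
              (2 * ((k : ℝ) + l) * ((k : ℝ) + l - 1) * f p.1 ^ 2) *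
            SingularGeometry.kulkarniNomizu
              (SingularGeometry.metricAt (SingularGeometry.euclideanWarped k l f) p)
              (SingularGeometry.metricAt (SingularGeometry.euclideanWarped k l f) p) a b c d) ∧
    -- it is unbounded on every tangent 2-plane of the base, near every zero of `f`
    (∀ p₀ : EuclideanSpace ℝ (Fin k) × EuclideanSpace ℝ (Fin l), f p₀.1 = 0 →
      ∀ u v : EuclideanSpace ℝ (Fin k), LinearIndependent ℝ ![u, v] →
        Filter.Tendsto
          (fun p => |SingularGeometry.scalarPart (SingularGeometry.euclideanWarped k l f) p
            (u, 0) (v, 0) (u, 0) (v, 0)|)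
          (nhdsWithin p₀ {p | f p.1 ≠ 0}) Filter.atTop) := by
  have hl' : 0 < l := by omega
  have hk' : 0 < k := by omega
  exact ⟨SingularGeometry.semiRegular_euclideanWarped hl' hf,
    SingularGeometry.not_quasiRegular_euclideanWarped hk hl hf,
    fun _ hp => SingularGeometry.scalarPart_euclideanWarped hp,
    fun _ hp _ _ huv =>
      SingularGeometry.tendsto_abs_scalarPart_euclideanWarped hk' hl hf hp huv⟩
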